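/- Let $K,N\ge 1$. For a finite graph $G=(V,E)$ let $STAB(G)\subseteq\mathbb R^V$ be the convex hull of the incidence vectors of the stable sets of $G$, let $QSTAB(G)=\{x\in\mathbb R^V: x\ge 0,\ \sum_{v\in Q}x_v\le 1\text{ for every clique }Q\text{ of }G\}$, and let $\operatorname{imp}(G)=\min\{t\in\mathbb R: QSTAB(G)\subseteq t\,STAB(G)\}$ be the imperfection ratio. Let $G_{K,N}$ be the enhanced conflict graph of the $K\times N$ switch with all unicasts and one broadcast per input: its vertices are $u_{ij}$ (the unicast from input $i$ to output $j$) and $b_{ij}$ (the subflow to output $j$ of the broadcast from input $i$), for $1\le i\le K$, $1\le j\le N$; its edges are $u_{ij}u_{ik}$ for $j\ne k$; $b_{ij}u_{ik}$ for all $i,j,k$; and $u_{ij}u_{kj}$, $b_{ij}b_{kj}$, $b_{ij}u_{kj}$ for $i\ne k$. Then the minimum defining $\operatorname{imp}(G_{K,N})$ is attained and $$\operatorname{imp}(G_{K,N})\le \frac{2N}{N+1}.$$ Moreover, let $P$ be a nonempty traffic pattern, i.e. a set of flows $(i,J)$ with $i\in\{1,\dots,K\}$ an input and $\emptyset\ne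 J\subseteq\{1,\dots,N\}$ a set of outputs, in which every flow is a unicast ($|J|=1$) or a broadcast ($J=\{1,\dots,N\}$). Let $A\subseteq\mathbb R_{\ge 0}^P$ be the set of admissible rate vectors $r$, i.e. $\sum_{(i',J)\in P,\,i'=i}r_{i'J}\le 1$ for each input $i$ and $\sum_{(i,J)\in P,\,J\ni j}r_{iJ}\le 1$ for each output $j$. Let $R$ be the rate region achievable with fanout splitting and linear intra-flow network coding: the closure of the set of all rate vectors $(n_f/F)_{f\in P}$, with integers $F\ge1$ and $n_f\ge 0$, such that some frame of $F$ slots conveys $n_f$ packets of every flow $f=(i,J)\in P$ to all outputs in $J$. Here in each slot every output receives from at most one input, and only from flows destined to it; every input serves at most one flow and sends one linear combination (over a finite field) of the $n_f$ packets of that flow to some subset of $J$; and at the end of the frame the coefficient vectors of flow $f$ received by each output in $J$ span the whole $n_f$-dimensional space. Then the minimum speedup $s_{\min}=\min\{s\in\mathbb R: A\subseteq sR\}$ is attained and $$s_{\min}\le\min\Big(\frac{2K-1}{K},\frac{2N}{N+1}\Big).$$ -/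

import Mathlib

open scoped Pointwise

/-! ## Stable set polytopes and the imperfection ratio of a (finite) graph -/

/-- The stable set polytope: the convex hull of the incidence vectors of the stable sets. -/
def stab {V : Type*} (G : SimpleGraph V) : Set (V → ℝ) :=
  convexHull ℝ {x | ∃ S : Set V, G.IsIndepSet S ∧ x = S.indicator 1}

/-- The fractional stable set polytope: nonnegativity and all clique inequalities. -/
def qstab {V : Type*} (G : SimpleGraph V) : Set (V → ℝ) :=
  {x | (∀ v, 0 ≤ x v) ∧ ∀ Q : Finset V, G.IsClique (Q : Set V) → ∑ v ∈ Q, x v ≤ 1}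

/-- The scalings `t` with `QSTAB(G) ⊆ t STAB(G)`. -/
def imperfectionScalings {V : Type*} (G : SimpleGraph V) : Set ℝ :=
  {t | qstab G ⊆ t • stab G}

/-- The imperfection ratio `imp(G) = min {t : QSTAB(G) ⊆ t STAB(G)}`, written as an infimum;
that it is attained is asserted separately where it is used. -/
noncomputable def imp {V : Type*} (G : SimpleGraph V) : ℝ :=
  sInf (imperfectionScalings G)

/-! ## The graph `G_{K,N}` for unicasts and one broadcast per input -/

/-- Vertices of `G_{K,N}`: `Sum.inl (i, j)` is the unicast `u_{ij}` from input `i` to output `j`,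
`Sum.inr (i, j)` is the subflow `b_{ij}` to output `j` of the broadcast from input `i`. -/
abbrev SwitchVertex (K N : ℕ) : Type := (Fin K × Fin N) ⊕ (Fin K × Fin N)

/-- The conflict relation of `G_{K,N}`: two unicasts conflict if they are distinct and share the
input or the output; a unicast and a broadcast subflow conflict if they share the input or the
output; two broadcast subflows conflict if they share the output and come from distinct inputs. -/
def switchAdj {K N : ℕ} : SwitchVertex K N → SwitchVertex K N → Prop
  | .inl (i, j), .inl (i', j') => (i = i' ∧ j ≠ j') ∨ (j = j' ∧ i ≠ i')
  | .inl (i, j), .inr (i', j') => i = i' ∨ j = j'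
  | .inr (i, j), .inl (i', j') => i = i' ∨ j = j'
  | .inr (i, j), .inr (i', j') => j = j' ∧ i ≠ i'

/-- The enhanced conflict graph `G_{K,N}`. -/
def switchGraph (K N : ℕ) : SimpleGraph (SwitchVertex K N) where
  Adj := switchAdj
  symm := ⟨by
    rintro (⟨i, j⟩ | ⟨i, j⟩) (⟨i', j'⟩ | ⟨i', j'⟩) h <;>
      simp only [switchAdj] at h ⊢ <;> tauto⟩
  loopless := ⟨by
    rintro (⟨i, j⟩ | ⟨i, j⟩) h <;> simp [switchAdj] at h⟩

/-! ## Flows, admissible rates, coded schedules and speedup in a `K × N` switch -/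

/-- A flow: an input together with a nonempty fanout set of outputs. -/
structure SwitchFlow (K N : ℕ) where
  input : Fin K
  fanout : Finset (Fin N)
  fanout_nonempty : fanout.Nonempty

/-- A flow is a unicast if its fanout is a single output. -/
def SwitchFlow.IsUnicast {K N : ℕ} (f : SwitchFlow K N) : Prop := ∃ j, f.fanout = {j}

/-- A flow is a broadcast if its fanout is the set of all outputs. -/
def SwitchFlow.IsBroadcast {K N : ℕ} (f : SwitchFlow K N) : Prop := f.fanout = Finset.univ

/-- The admissible rate region of a traffic pattern (a finite collection of flows): nonnegative
rate vectors for which no input and no output is oversubscribed. -/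
def admissibleRegion {K N : ℕ} (P : Finset (SwitchFlow K N)) : Set (P → ℝ) :=
  {r | (∀ f, 0 ≤ r f) ∧
    (∀ i : Fin K, ∑ f : P, (if f.1.input = i then r f else 0) ≤ 1) ∧
    (∀ j : Fin N, ∑ f : P, (if j ∈ f.1.fanout then r f else 0) ≤ 1)}

/-- A configuration of the switch during one slot, given by the flow (if any) from which each
output receives a packet. An output receives from at most one input (`conf` is a function), only
flows destined to it, and an input serves at most one flow, possibly to only a part of its fanout
(fanout splitting). -/
def IsSwitchConfiguration {K N : ℕ} {P : Finset (SwitchFlow K N)} (conf : Fin N → Option P) : Prop :=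
  (∀ j f, conf j = some f → j ∈ f.1.fanout) ∧
    ∀ j j' f f', conf j = some f → conf j' = some f' → f.1.input = f'.1.input → f = f'

/-- A frame of `F` slots can convey `n f` packets of each flow `f` to all the outputs in the fanout
of `f`, using fanout splitting and linear intra-flow coding over some finite field.
In slot `t` the switch is in configuration `conf t`, and the packet of flow `f` sent in slot `t`
(the same one to all outputs that are served) is the linear combination of the `n f` packets
with coefficient vector `c t f`. At the end of the frame, the knowledge space of each output
in the fanout, i.e. the span of the coefficient vectors that it received, must be everything. -/
def FrameServes {K N : ℕ} (P : Finset (SwitchFlow K N)) (F : ℕ) (n : P → ℕ) : Prop :=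
  ∃ (𝔽 : Type) (_ : Field 𝔽) (_ : Finite 𝔽)
    (conf : Fin F → Fin N → Option P) (c : Fin F → (f : P) → (Fin (n f) → 𝔽)),
    (∀ t, IsSwitchConfiguration (conf t)) ∧
    ∀ f : P, ∀ j ∈ f.1.fanout,
      Submodule.span 𝔽 {v | ∃ t, conf t j = some f ∧ v = c t f} = ⊤

/-- The achievable rate region with linear intra-flow network coding and fanout splitting (without
speedup): rate vectors served by a frame-based schedule, and their limits. (A single frame only
gives rational rates; arbitrary real rates are obtained by the closure.) -/
def achievableRegion {K N : ℕ} (P : Finset (SwitchFlow K N)) : Set (P → ℝ) :=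
  closure {r | ∃ (F : ℕ) (n : P → ℕ), 0 < F ∧ FrameServes P F n ∧ ∀ f, r f = (n f : ℝ) / F}

/-- The speedups `s` with which every admissible rate vector is achievable: `A ⊆ s R`. -/
def sufficientSpeedups {K N : ℕ} (P : Finset (SwitchFlow K N)) : Set ℝ :=
  {s | admissibleRegion P ⊆ s • achievableRegion P}

/-- The minimum speedup `s_min = min {s : A ⊆ s R}`, written as an infimum; that it is attained
is asserted separately where it is used. -/
noncomputable def minSpeedup {K N : ℕ} (P : Finset (SwitchFlow K N)) : ℝ :=
  sInf (sufficientSpeedups P)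

/-!
Both bounds rest on covering the load of the switch by parts that can be scheduled perfectly.

Write `u i j` and `b i j` for the loads of the unicasts `u_{ij}` and of the broadcast subflows
`b_{ij}`. Points of `QSTAB(G_{K,N})`, and the loads caused by admissible rates, satisfy the
inequalities of `IsSwitchLoad`: for each input `i` and output `j`, `∑ k, u i k + b i j ≤ 1`, and for
each output `j`, `∑ i, (u i j + b i j) ≤ 1`. Three kinds of restrictions of such a load lie in the
stable set polytope:

* the unicasts of one input and all broadcasts (`IsSwitchLoad.row_mem_stab`),
* the unicasts to one output and all broadcasts (`IsSwitchLoad.column_mem_stab`),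
* all unicasts and the broadcast subflows to one output (`IsSwitchLoad.unicast_mem_stab`).

In the first two, the unicasts are served one at a time, and each output then chooses independently
of the others which broadcast to receive; that such choices combine to a point of the stable set
polytope is `switchVec_mem_stab_of_mixture`, and the choices needed for the second are the couplings
of `exists_coupling_diag_eq_zero`. The third is bipartite edge colouring, that is, Birkhoff's
theorem.

Taking the second and the third restriction for each output gives `2 N` points that add up to
`N + 1` times the load. Taking the first for each input and `K - 1` times the unicasts alone gives
`2 K - 1` points that add up to `K` times the load. Averaging, the load lies in `2 N / (N + 1)`
times and in `(2 K - 1) / K` times the stable set polytope.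

Finally, points of the stable set polytope are achievable rates
(`mem_achievableRegion_of_mem_stab`). A frame shares its slots between the switch configurations
given by stable sets. The subflows of a broadcast may be served at different times at different
outputs, and this is harmless because with Vandermonde coefficients over a large prime field any
`n` coded packets of a flow determine its `n` packets. The minima are attained because the stable
set polytope and the achievable region are closed and contained in the unit cube, while the regions
to be covered contain a unit vector.
-/

/-! ### Loads of the switch and convex combinations of stable sets -/

/-- The vector on the vertices of `G_{K,N}` with value `u i j` at `u_{ij}` and `b i j` at
`b_{ij}`. -/
def switchVec {K N : ℕ} (u b : Fin K → Fin N → ℝ) : SwitchVertex K N → ℝ :=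
  Sum.elim (fun e => u e.1 e.2) (fun e => b e.1 e.2)

/-- Nonnegative loads `u` of the unicasts and `b` of the broadcast subflows that satisfy the
clique inequalities of `G_{K,N}` for the cliques `{u_{ik} : k} ∪ {b_{ij}}` and
`{u_{ij} : i} ∪ {b_{ij} : i}`. No other inequality of `QSTAB` is needed. -/
structure IsSwitchLoad {K N : ℕ} (u b : Fin K → Fin N → ℝ) : Prop where
  unicast_nonneg : ∀ i j, 0 ≤ u i j
  broadcast_nonneg : ∀ i j, 0 ≤ b i j
  input_le : ∀ i j, ∑ k, u i k + b i j ≤ 1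
  output_le : ∀ j, ∑ i, u i j + ∑ i, b i j ≤ 1

/-- A set of unicasts that pairwise share neither the input nor the output. -/
def IsUnicastMatching {K N : ℕ} (U : Set (Fin K × Fin N)) : Prop :=
  ∀ e ∈ U, ∀ e' ∈ U, e.1 = e'.1 ∨ e.2 = e'.2 → e = e'

/-- A subprobability vector is a convex combination of `0` and the unit vectors in its support. -/
lemma mem_convexHull_single_of_sum_le_one {ι : Type*} [Fintype ι] [DecidableEq ι] {y : ι → ℝ}
    (hy0 : ∀ i, 0 ≤ y i) (hy1 : ∑ i, y i ≤ 1) :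
    y ∈ convexHull ℝ {z : ι → ℝ | z = 0 ∨ ∃ i, y i ≠ 0 ∧ z = Pi.single i 1} := by
  refine mem_convexHull_of_exists_fintype (ι := Option ι)
    (fun o => o.elim (1 - ∑ i, y i) y)
    (fun o => o.elim 0 (fun i => if y i = 0 then 0 else Pi.single i 1)) ?_ ?_ ?_ ?_
  · rintro (_ | i)
    · simpa using hy1
    · exact hy0 i
  · simp [Fintype.sum_option]
  · rintro (_ | i)
    · exact Or.inl rfl
    · by_cases h : y i = 0
      · simp [h]
      · exact Or.inr ⟨i, h, by simp [h]⟩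
  · ext i
    have hterm : ∀ k, y k * (if y k = 0 then (0 : ι → ℝ) else Pi.single k 1) i =
        if k = i then y i else 0 := by
      intro k
      rcases eq_or_ne k i with rfl | hk
      · by_cases h : y k = 0 <;> simp [h]
      · by_cases h : y k = 0 <;> simp [h, hk, hk.symm]
    simp [Fintype.sum_option, hterm]

lemma convex_stab {V : Type*} (G : SimpleGraph V) : Convex ℝ (stab G) :=
  convex_convexHull ℝ _

/-- While a fixed matching of unicasts is served, the outputs can choose independently of each
other which broadcast to listen to, since subflows of broadcasts to distinct outputs never
conflict. -/
lemma switchVec_indicator_mem_stab {K N : ℕ} {U : Set (Fin K × Fin N)}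
    (hU : IsUnicastMatching U) {y : Fin K → Fin N → ℝ}
    (hy0 : ∀ i j, 0 ≤ y i j) (hy1 : ∀ j, ∑ i, y i j ≤ 1)
    (hyU : ∀ i j, y i j ≠ 0 → ∀ e ∈ U, e.1 ≠ i ∧ e.2 ≠ j) :
    switchVec (fun i j => U.indicator 1 (i, j)) y ∈ stab (switchGraph K N) := by
  classical
  have hy := mem_convexHull_pi (𝕜 := ℝ) (s := Set.univ) (x := fun j i => y i j) fun j _ =>
    mem_convexHull_single_of_sum_le_one (fun i => hy0 i j) (hy1 j)
  suffices convexHull ℝ (Set.univ.pi fun j : Fin N =>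
      {z : Fin K → ℝ | z = 0 ∨ ∃ i, y i j ≠ 0 ∧ z = Pi.single i 1}) ⊆
      {Y | switchVec (fun i j => U.indicator 1 (i, j)) (fun i j => Y j i) ∈
        stab (switchGraph K N)} from this hy
  refine convexHull_min (fun Y hY => subset_convexHull _ _ ?_) ?_
  · refine ⟨{v | Sum.elim (· ∈ U) (fun e => Y e.2 e.1 = 1) v}, ?_, ?_⟩
    · have key : ∀ i j, Y j i = 1 → y i j ≠ 0 ∧ ∀ k, Y j k = 1 → k = i := by
        intro i j h
        rcases hY j trivial with h0 | ⟨l, hl, hz⟩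
        · simp [h0] at h
        · have : i = l := by
            by_contra hne
            simp [hz, hne] at h
          subst this
          refine ⟨hl, fun k hk => ?_⟩
          by_contra hne
          simp [hz, hne] at hk
      rintro (⟨i, j⟩ | ⟨i, j⟩) h (⟨i', j'⟩ | ⟨i', j'⟩) h' hne hadj <;>
        simp only [Set.mem_ofPred_eq, Sum.elim_inl, Sum.elim_inr] at h h' <;>
        simp only [switchGraph, switchAdj] at hadj
      · have := hU _ h _ h' (by tauto)
        simp_all
      · have := hyU _ _ (key _ _ h').1 _ h
        tauto
      · have := hyU _ _ (key _ _ h).1 _ h'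
        grind
      · obtain ⟨rfl, hij⟩ := hadj
        exact hij ((key _ _ h').2 _ h)
    · ext (⟨i, j⟩ | ⟨i, j⟩)
      · by_cases h : (i, j) ∈ U <;> simp [switchVec, Set.indicator_apply, h]
      · simp only [switchVec, Sum.elim_inr, Set.indicator, Set.mem_ofPred_eq, Pi.one_apply]
        rcases hY j trivial with h0 | ⟨l, hl, hz⟩
        · simp [h0]
        · by_cases h : i = l
          · simp [hz, h]
          · simp [hz, h]
  · intro Y hY Z hZ p q hp hq hpq
    rw [Set.mem_ofPred_eq] at hY hZ ⊢
    convert convex_stab _ hY hZ hp hq hpq using 1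
    ext (⟨i, j⟩ | ⟨i, j⟩)
    · simp only [switchVec, Sum.elim_inl, Pi.add_apply, Pi.smul_apply, smul_eq_mul]
      rw [← add_mul, hpq, one_mul]
    · simp [switchVec]

/-- A random matching `U ω` of unicasts, chosen with probability `w ω`, together with joint
probabilities `p ω i j` that `U ω` is chosen and output `j` receives the broadcast of input `i`,
yields a point of the stable set polytope. -/
lemma switchVec_mem_stab_of_mixture {K N : ℕ} {ι : Type*} [Fintype ι] {w : ι → ℝ}
    (hw0 : ∀ ω, 0 ≤ w ω) (hw1 : ∑ ω, w ω = 1) {U : ι → Set (Fin K × Fin N)}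
    (hU : ∀ ω, IsUnicastMatching (U ω)) {p : ι → Fin K → Fin N → ℝ}
    (hp0 : ∀ ω i j, 0 ≤ p ω i j) (hp : ∀ ω j, ∑ i, p ω i j ≤ w ω)
    (hpU : ∀ ω i j, p ω i j ≠ 0 → ∀ e ∈ U ω, e.1 ≠ i ∧ e.2 ≠ j)
    {u b : Fin K → Fin N → ℝ} (hu : ∀ i j, u i j = ∑ ω, w ω * (U ω).indicator 1 (i, j))
    (hb : ∀ i j, b i j = ∑ ω, p ω i j) :
    switchVec u b ∈ stab (switchGraph K N) := by
  have hmem : ∀ ω, switchVec (fun i j => (U ω).indicator 1 (i, j)) (fun i j => p ω i j / w ω) ∈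
      stab (switchGraph K N) := by
    refine fun ω => switchVec_indicator_mem_stab (hU ω) (fun i j => div_nonneg (hp0 _ _ _) (hw0 _))
      (fun j => ?_) fun i j h => hpU ω i j fun h0 => h (by simp [h0])
    rw [← Finset.sum_div]
    exact div_le_one_of_le₀ (hp ω j) (hw0 ω)
  have := (convex_stab _).sum_mem (t := Finset.univ) (fun ω _ => hw0 ω) hw1
    (fun ω _ => hmem ω)
  convert this using 1
  ext (⟨i, j⟩ | ⟨i, j⟩)
  · simp [switchVec, hu]
  · simp only [switchVec, Sum.elim_inr, hb, Finset.sum_apply, Pi.smul_apply, smul_eq_mul]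
    refine Finset.sum_congr rfl fun ω _ => ?_
    by_cases h : w ω = 0
    · have h1 : p ω i j ≤ 0 := by
        rw [← h]
        exact (Finset.single_le_sum (fun k _ => hp0 ω k j) (Finset.mem_univ i)).trans (hp ω j)
      simp [h, le_antisymm h1 (hp0 _ _ _)]
    · field_simp

/-! ### One row of unicasts and all broadcasts -/

/-- The unicasts of one input `i` together with all broadcast subflows. While input `i` serves no
unicast, each output `j` first gets its share of the broadcast of `i`, and the broadcasts of the
other inputs fill the time left at output `j` proportionally. -/
lemma IsSwitchLoad.row_mem_stab {K N : ℕ} {u b : Fin K → Fin N → ℝ} (h : IsSwitchLoad u b)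
    (i : Fin K) :
    switchVec (fun k j => if k = i then u k j else 0) b ∈ stab (switchGraph K N) := by
  classical
  have hu := h.unicast_nonneg
  have hb := h.broadcast_nonneg
  set w : Option (Fin N) → ℝ := fun o => o.elim (1 - ∑ l, u i l) (u i) with hw
  -- `cap ω j` is the time during which output `j` is free for broadcasts of inputs other than `i`
  set cap : Option (Fin N) → Fin N → ℝ :=
    fun o j => o.elim (1 - ∑ l, u i l - b i j) (fun l => if l = j then 0 else u i l) with hcap
  have hcap0 : ∀ o j, 0 ≤ cap o j := by
    rintro (_ | l) j
    · have := h.input_le i j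
      simp only [hcap, Option.elim]; linarith
    · simp only [hcap, Option.elim]; split_ifs <;> simp [hu]
  have hcapsum : ∀ j, ∑ o, cap o j = 1 - u i j - b i j := by
    intro j
    have : ∀ l, (if l = j then 0 else u i l) = u i l - if l = j then u i l else 0 := by
      intro l; split_ifs <;> simp
    simp only [hcap, Fintype.sum_option, Option.elim, this, Finset.sum_sub_distrib,
      Finset.sum_ite_eq', Finset.mem_univ, if_true]
    ring
  have hrest : ∀ j, ∑ k ∈ Finset.univ.erase i, b k j ≤ 1 - u i j - b i j := by
    intro j
    have h1 := h.output_le j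
    have h2 := Finset.add_sum_erase Finset.univ (fun k => b k j) (Finset.mem_univ i)
    have h3 := Finset.single_le_sum (fun k _ => hu k j) (Finset.mem_univ i)
    linarith
  have hc0 : ∀ j, 0 ≤ 1 - u i j - b i j := fun j =>
    (Finset.sum_nonneg fun k _ => hb k j).trans (hrest j)
  refine switchVec_mem_stab_of_mixture (w := w)
    (U := fun o => o.elim ∅ (fun l => {(i, l)}))
    (p := fun o k j => if k = i then o.elim (b i j) 0 else
      cap o j * (b k j / (1 - u i j - b i j))) ?_ ?_ ?_ ?_ ?_ ?_ ?_ ?_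
  · rintro (_ | l)
    · by_cases hN : Nonempty (Fin N)
      · obtain ⟨j⟩ := hN
        have := h.input_le i j
        have := hb i j
        simp only [hw, Option.elim]; linarith
      · rw [not_nonempty_iff] at hN
        simp [hw]
    · exact hu _ _
  · simp [hw, Fintype.sum_option]
  · rintro (_ | l) <;> simp [IsUnicastMatching]
  · intro o k j
    split_ifs
    · cases o <;> simp [hb]
    · exact mul_nonneg (hcap0 _ _) (div_nonneg (hb _ _) (hc0 _))
  · intro o j
    have hle : ∑ k ∈ Finset.univ.erase i, cap o j * (b k j / (1 - u i j - b i j)) ≤ cap o j := by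
      rw [← Finset.mul_sum, ← Finset.sum_div]
      exact mul_le_of_le_one_right (hcap0 _ _) (div_le_one_of_le₀ (hrest j) (hc0 j))
    rw [← Finset.add_sum_erase _ _ (Finset.mem_univ i), if_pos rfl]
    rw [Finset.sum_congr rfl fun k hk => if_neg (Finset.ne_of_mem_erase hk)]
    rcases o with _ | l
    · simp only [hw, hcap, Option.elim] at hle ⊢
      linarith
    · simp only [hw, hcap, Option.elim, Pi.zero_apply, zero_add] at hle ⊢
      refine hle.trans ?_
      split_ifs
      exacts [hu _ _, le_rfl]
  · rintro (_ | l) k j hne e he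
    · simp at he
    · simp only [Option.elim, Set.mem_singleton_iff] at he
      subst he
      by_cases hk : k = i
      · simp [hk] at hne
      · refine ⟨Ne.symm hk, fun hl => hne ?_⟩
        simp only at hl
        simp [hcap, hl]
  · intro k j
    by_cases hk : k = i
    · subst hk
      simp only [Fintype.sum_option, hw, Option.elim, if_true, mul_zero, Set.indicator,
        Set.mem_singleton_iff, Prod.mk.injEq, true_and, Pi.one_apply,
        mul_ite, mul_one]
      simp
    · simp only [Fintype.sum_option, hw, Option.elim, mul_zero, Set.indicator,
        Set.mem_singleton_iff, Prod.mk.injEq, hk, false_and, if_false]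
      simp
  · intro k j
    by_cases hk : k = i
    · subst hk
      simp [Fintype.sum_option]
    · simp only [hk, if_false]
      rw [← Finset.sum_mul, hcapsum]
      by_cases hc : 1 - u i j - b i j = 0
      · have h1 := hrest j
        rw [hc] at h1
        have h2 := (Finset.single_le_sum (fun k _ => hb k j)
          (Finset.mem_erase.2 ⟨hk, Finset.mem_univ k⟩)).trans h1
        simp [hc, le_antisymm h2 (hb k j)]
      · field_simp

/-! ### One column of unicasts and all broadcasts -/

/-- Two probability vectors `w` and `d` have a coupling that avoids the diagonal positions in `D`
as soon as `w i + d i ≤ 1` for all `i ∈ D`. A coupling of least mass on these positions will do: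
positive mass at `(i, i)` forces positive mass at some `(a, c)` with `a ≠ i` and `c ≠ i`, and
exchanging mass between the two lowers the total. -/
lemma exists_coupling_diag_eq_zero {α : Type*} [Fintype α] [DecidableEq α] {w d : α → ℝ}
    (hw0 : ∀ i, 0 ≤ w i) (hd0 : ∀ i, 0 ≤ d i) (hw1 : ∑ i, w i = 1) (hd1 : ∑ i, d i = 1)
    (D : Finset α) (hD : ∀ i ∈ D, w i + d i ≤ 1) :
    ∃ q : α → α → ℝ, (∀ i j, 0 ≤ q i j) ∧ (∀ i, ∑ j, q i j = w i) ∧ (∀ j, ∑ i, q i j = d j) ∧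
      ∀ i ∈ D, q i i = 0 := by
  set S : Set (α → α → ℝ) := {q | (∀ i j, 0 ≤ q i j) ∧ (∀ i, ∑ j, q i j = w i) ∧
    ∀ j, ∑ i, q i j = d j} with hS
  have hclosed : IsClosed S := by
    simp only [hS, Set.ofPred_and, Set.ofPred_forall]
    refine IsClosed.inter ?_ (IsClosed.inter ?_ ?_)
    · exact isClosed_iInter fun i => isClosed_iInter fun j =>
        isClosed_le continuous_const (by fun_prop)
    · exact isClosed_iInter fun i => isClosed_eq (by fun_prop) continuous_const
    · exact isClosed_iInter fun i => isClosed_eq (by fun_prop) continuous_const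
  have hcompact : IsCompact S := by
    refine (isCompact_Icc (a := (0 : α → α → ℝ)) (b := fun i _ => w i)).of_isClosed_subset
      hclosed ?_
    rintro q ⟨h0, h1, -⟩
    refine ⟨fun i j => h0 i j, fun i j => ?_⟩
    change q i j ≤ w i
    rw [← h1 i]
    exact Finset.single_le_sum (fun k _ => h0 i k) (Finset.mem_univ j)
  have hne : S.Nonempty := by
    refine ⟨fun i j => w i * d j, fun i j => mul_nonneg (hw0 i) (hd0 j), fun i => ?_, fun j => ?_⟩
    · rw [← Finset.mul_sum, hd1, mul_one]
    · rw [← Finset.sum_mul, hw1, one_mul]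
  obtain ⟨q, ⟨hq0, hqw, hqd⟩, hmin⟩ := hcompact.exists_isMinOn hne
    (f := fun q : α → α → ℝ => ∑ i ∈ D, q i i) (by fun_prop)
  refine ⟨q, hq0, hqw, hqd, fun i hi => ?_⟩
  by_contra hqi
  have hpos : 0 < q i i := lt_of_le_of_ne (hq0 i i) (Ne.symm hqi)
  obtain ⟨a, ha, c, hc, hac⟩ : ∃ a, a ≠ i ∧ ∃ c, c ≠ i ∧ 0 < q a c := by
    by_contra! hcon
    have hz : ∀ a ∈ Finset.univ.erase i, w a = q a i := by
      intro a ha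
      rw [← hqw a]
      refine Finset.sum_eq_single i (fun c _ hc => ?_) (by simp)
      exact le_antisymm (hcon a (Finset.ne_of_mem_erase ha) c hc) (hq0 a c)
    have h1 := Finset.add_sum_erase Finset.univ w (Finset.mem_univ i)
    have h2 := Finset.add_sum_erase Finset.univ (fun a => q a i) (Finset.mem_univ i)
    rw [Finset.sum_congr rfl hz, hw1] at h1
    rw [hqd i] at h2
    have h3 := hD i hi
    linarith
  set ε := min (q i i) (q a c) with hε
  have hε0 : 0 < ε := lt_min hpos hac
  have hε1 : ε ≤ q i i := min_le_left _ _
  have hε2 : ε ≤ q a c := min_le_right _ _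
  -- move mass `ε` from `(i, i)` and `(a, c)` to `(i, c)` and `(a, i)`
  set q' : α → α → ℝ := fun x y => q x y - ε *
    (((if x = i then 1 else 0) - if x = a then 1 else 0) *
      ((if y = i then 1 else 0) - if y = c then 1 else 0)) with hq'
  have hq'S : q' ∈ S := by
    refine ⟨fun x y => ?_, fun x => ?_, fun y => ?_⟩
    · have := hq0 x y
      simp only [hq']
      split_ifs <;> (subst_vars; norm_num; linarith)
    · simp [hq', Finset.sum_sub_distrib, ← Finset.mul_sum, hqw]
    · simp [hq', Finset.sum_sub_distrib, ← Finset.mul_sum, ← Finset.sum_mul, hqd]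
  have hle := hmin hq'S
  simp only [hq', Set.mem_ofPred_eq, Finset.sum_sub_distrib, ← Finset.mul_sum] at hle
  have hge : (1 : ℝ) ≤ ∑ x ∈ D, (((if x = i then 1 else 0) - if x = a then 1 else 0) *
      ((if x = i then 1 else 0) - if x = c then 1 else 0)) := by
    refine le_trans ?_ (Finset.single_le_sum (fun x _ => ?_) hi)
    · simp [ha.symm, hc.symm]
    · split_ifs <;> simp_all
  nlinarith

/-- The unicasts to one output `j` together with all broadcast subflows. Each output other than `j`
couples the broadcast it receives with the unicast served, avoiding equal inputs. -/
lemma IsSwitchLoad.column_mem_stab {K N : ℕ} {u b : Fin K → Fin N → ℝ} (h : IsSwitchLoad u b)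
    (j : Fin N) :
    switchVec (fun i k => if k = j then u i k else 0) b ∈ stab (switchGraph K N) := by
  classical
  have hu := h.unicast_nonneg
  have hb := h.broadcast_nonneg
  set w : Option (Fin K) → ℝ := fun o => o.elim (1 - ∑ i, u i j) (fun i => u i j) with hw
  have hw0 : ∀ o, 0 ≤ w o := by
    rintro (_ | i)
    · have := h.output_le j
      have := Finset.sum_nonneg fun i (_ : i ∈ Finset.univ) => hb i j
      simp only [hw, Option.elim]; linarith
    · exact hu _ _
  have hw1 : ∑ o, w o = 1 := by simp [hw, Fintype.sum_option]
  have hq : ∀ k, ∃ q : Option (Fin K) → Option (Fin K) → ℝ, (∀ o o', 0 ≤ q o o') ∧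
      (∀ o, ∑ o', q o o' = w o) ∧ (∀ i, ∑ o, q o (some i) = b i k) ∧
      ∀ i, q (some i) (some i) = 0 := by
    intro k
    have hd0 : ∀ o : Option (Fin K), 0 ≤ o.elim (1 - ∑ i, b i k) (fun i => b i k) := by
      rintro (_ | i)
      · have := h.output_le k
        have := Finset.sum_nonneg fun i (_ : i ∈ Finset.univ) => hu i k
        simp only [Option.elim]; linarith
      · exact hb _ _
    obtain ⟨q, h0, h1, h2, h3⟩ := exists_coupling_diag_eq_zero hw0 hd0 hw1
      (by simp [Fintype.sum_option]) (Finset.univ.image some) (by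
        simp only [Finset.mem_image, Finset.mem_univ, true_and, forall_exists_index,
          forall_apply_eq_imp_iff]
        intro i
        have h1 := h.input_le i k
        have h2 := Finset.single_le_sum (fun l _ => hu i l) (Finset.mem_univ j)
        simp only [hw, Option.elim]; linarith)
    exact ⟨q, h0, h1, fun i => h2 (some i), fun i => h3 _ (by simp)⟩
  choose q hq0 hqw hqb hqd using hq
  refine switchVec_mem_stab_of_mixture (w := w)
    (U := fun o => o.elim ∅ (fun i => {(i, j)}))
    (p := fun o i k => if k = j then o.elim (b i j) 0 else q k o (some i))
    hw0 hw1 ?_ ?_ ?_ ?_ ?_ ?_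
  · rintro (_ | l) <;> simp [IsUnicastMatching]
  · intro o i k
    split_ifs
    · cases o <;> simp [hb]
    · exact hq0 _ _ _
  · intro o k
    by_cases hk : k = j
    · subst hk
      simp only [if_true]
      rcases o with _ | i
      · have := h.output_le k
        simp only [hw, Option.elim]; linarith
      · simp [hw, hu]
    · simp only [hk, if_false]
      rw [← hqw k o, Fintype.sum_option]
      exact le_add_of_nonneg_left (hq0 _ _ _)
  · rintro (_ | l) i k hne e he
    · simp at he
    · simp only [Option.elim, Set.mem_singleton_iff] at he
      subst he
      by_cases hk : k = j
      · simp [hk] at hne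
      · refine ⟨fun hl => hne ?_, Ne.symm hk⟩
        simp only at hl
        simp [hk, hl, hqd]
  · intro i k
    by_cases hk : k = j
    · subst hk
      simp [Fintype.sum_option, hw, Set.indicator]
    · simp [Fintype.sum_option, Set.indicator, hk]
  · intro i k
    by_cases hk : k = j
    · subst hk
      simp [Fintype.sum_option]
    · simp [hk, hqb]

/-! ### All unicasts and one column of broadcasts -/

/-- A nonnegative rectangular matrix with row and column sums at most `1` is a convex combination
of matchings `{(i, j) | σ (inl i) = inr j}`, where `σ` permutes the disjoint union of the rows and
the columns. This is Birkhoff's theorem for the symmetric doubly stochastic matrix with `M` and its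
transpose off the diagonal. -/
lemma exists_eq_sum_perm_of_row_sum_le_one {α β : Type*} [Fintype α] [Fintype β] [DecidableEq α]
    [DecidableEq β] {M : α → β → ℝ} (h0 : ∀ i j, 0 ≤ M i j) (hr : ∀ i, ∑ j, M i j ≤ 1)
    (hc : ∀ j, ∑ i, M i j ≤ 1) :
    ∃ w : Equiv.Perm (α ⊕ β) → ℝ, (∀ σ, 0 ≤ w σ) ∧ ∑ σ, w σ = 1 ∧
      ∀ i j, M i j = ∑ σ, if σ (.inl i) = .inr j then w σ else 0 := by
  set A : Matrix (α ⊕ β) (α ⊕ β) ℝ := Matrix.fromBlocks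
    (Matrix.diagonal fun i => 1 - ∑ j, M i j) (Matrix.of M) (Matrix.of M).transpose
    (Matrix.diagonal fun j => 1 - ∑ i, M i j) with hA
  have hAmem : A ∈ doublyStochastic ℝ (α ⊕ β) := by
    rw [mem_doublyStochastic_iff_sum]
    refine ⟨?_, ?_, ?_⟩
    · rintro (i | i) (j | j) <;> simp only [hA, Matrix.fromBlocks_apply₁₁,
        Matrix.fromBlocks_apply₁₂, Matrix.fromBlocks_apply₂₁, Matrix.fromBlocks_apply₂₂,
        Matrix.diagonal_apply, Matrix.of_apply, Matrix.transpose_apply]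
      · split_ifs
        exacts [sub_nonneg.2 (hr i), le_rfl]
      · exact h0 _ _
      · exact h0 _ _
      · split_ifs
        exacts [sub_nonneg.2 (hc i), le_rfl]
    · rintro (i | i) <;> simp [hA, Matrix.diagonal_apply]
    · rintro (i | i) <;> simp [hA, Matrix.diagonal_apply]
  obtain ⟨w, hw0, hw1, hw⟩ := exists_eq_sum_perm_of_mem_doublyStochastic hAmem
  refine ⟨w, hw0, hw1, fun i j => ?_⟩
  have := congrFun (congrFun hw (.inl i)) (.inr j)
  simp only [hA, Matrix.fromBlocks_apply₁₂, Matrix.of_apply, Matrix.sum_apply] at this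
  rw [← this]
  refine Finset.sum_congr rfl fun σ _ => ?_
  simp [Equiv.Perm.permMatrix, PEquiv.toMatrix_apply, eq_comm]

/-- All unicasts together with the broadcast subflows to one output `j`. These conflict like the
edges of a bipartite multigraph, `b_{ij}` being a second edge parallel to `u_{ij}`. Each matching in
Birkhoff's decomposition of the total load is split between the two parallel edges. -/
lemma IsSwitchLoad.unicast_mem_stab {K N : ℕ} {u b : Fin K → Fin N → ℝ} (h : IsSwitchLoad u b)
    (j : Fin N) :
    switchVec u (fun i k => if k = j then b i k else 0) ∈ stab (switchGraph K N) := by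
  classical
  have hu := h.unicast_nonneg
  have hb := h.broadcast_nonneg
  set M : Fin K → Fin N → ℝ := fun i k => u i k + if k = j then b i k else 0 with hM
  have hM0 : ∀ i k, 0 ≤ M i k := by
    intro i k
    have := hu i k
    have := hb i k
    simp only [hM]
    split_ifs <;> linarith
  have hMr : ∀ i, ∑ k, M i k ≤ 1 := by
    intro i
    simpa [hM, Finset.sum_add_distrib] using h.input_le i j
  have hMc : ∀ k, ∑ i, M i k ≤ 1 := by
    intro k
    by_cases hk : k = j
    · simpa [hM, hk, Finset.sum_add_distrib] using h.output_le j
    · have := h.output_le k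
      have := Finset.sum_nonneg fun i (_ : i ∈ Finset.univ) => hb i k
      simp only [hM, hk, if_false, add_zero]
      linarith
  obtain ⟨w, hw0, hw1, hw⟩ := exists_eq_sum_perm_of_row_sum_le_one hM0 hMr hMc
  -- the share of the unicast in the load of the pair served by output `j`
  set ρ : Equiv.Perm (Fin K ⊕ Fin N) → ℝ :=
    fun σ => ∑ i, if σ (.inl i) = .inr j then u i j / M i j else 0 with hρ
  have hMj : ∀ i, M i j = u i j + b i j := by simp [hM]
  have hρeq : ∀ σ i, σ (.inl i) = .inr j → ρ σ = u i j / M i j := by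
    intro σ i hi
    simp only [hρ]
    rw [Finset.sum_eq_single i]
    · simp [hi]
    · intro i' _ hne
      rw [if_neg]
      intro h'
      exact hne (Sum.inl_injective (σ.injective (h'.trans hi.symm)))
    · simp
  have hρ01 : ∀ σ, 0 ≤ ρ σ ∧ ρ σ ≤ 1 := by
    intro σ
    by_cases hex : ∃ i, σ (.inl i) = .inr j
    · obtain ⟨i, hi⟩ := hex
      rw [hρeq σ i hi, hMj]
      exact ⟨div_nonneg (hu _ _) (add_nonneg (hu _ _) (hb _ _)),
        div_le_one_of_le₀ (by linarith [hb i j]) (add_nonneg (hu _ _) (hb _ _))⟩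
    · push Not at hex
      simp [hρ, hex]
  have hinj : ∀ (σ : Equiv.Perm (Fin K ⊕ Fin N)) (i i' : Fin K) (k : Fin N),
      σ (.inl i) = .inr k → σ (.inl i') = .inr k → i = i' := fun σ i i' k h1 h2 =>
    Sum.inl_injective (σ.injective (h1.trans h2.symm))
  -- at output `j`, the matching of `σ` uses the unicast (`true`) or the broadcast (`false`)
  refine switchVec_mem_stab_of_mixture (ι := Equiv.Perm (Fin K ⊕ Fin N) × Bool)
    (w := fun ω => w ω.1 * if ω.2 then ρ ω.1 else 1 - ρ ω.1)
    (U := fun ω => {e | ω.1 (.inl e.1) = .inr e.2 ∧ (ω.2 = false → e.2 ≠ j)})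
    (p := fun ω i k => if ω.2 = false ∧ k = j ∧ ω.1 (.inl i) = .inr j then
      w ω.1 * (1 - ρ ω.1) else 0) ?_ ?_ ?_ ?_ ?_ ?_ ?_ ?_
  · rintro ⟨σ, _ | _⟩
    · exact mul_nonneg (hw0 σ) (by simpa using (hρ01 σ).2)
    · exact mul_nonneg (hw0 σ) (by simpa using (hρ01 σ).1)
  · rw [Fintype.sum_prod_type]
    refine (Finset.sum_congr rfl fun σ _ => ?_).trans hw1
    simp; ring
  · rintro ⟨σ, c⟩ ⟨i, k⟩ ⟨h1, -⟩ ⟨i', k'⟩ ⟨h2, -⟩ hor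
    simp only at h1 h2 hor
    rcases hor with rfl | rfl
    · rw [h1] at h2
      simpa using h2
    · simpa using hinj _ _ _ _ h1 h2
  · rintro ⟨σ, c⟩ i k
    dsimp only
    split_ifs
    · exact mul_nonneg (hw0 σ) (by simpa using (hρ01 σ).2)
    · exact le_rfl
  · rintro ⟨σ, _ | _⟩ k
    · by_cases hk : k = j
      · by_cases hex : ∃ i, σ (.inl i) = .inr j
        · obtain ⟨i, hi⟩ := hex
          rw [Finset.sum_eq_single i]
          · simp [hk, hi]
          · intro i' _ hne
            rw [if_neg]
            rintro ⟨-, -, h'⟩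
            exact hne (hinj _ _ _ _ h' hi)
          · simp
        · push Not at hex
          simpa [hex] using mul_nonneg (hw0 σ) (sub_nonneg.2 (hρ01 σ).2)
      · simpa [hk] using mul_nonneg (hw0 σ) (sub_nonneg.2 (hρ01 σ).2)
    · simpa using mul_nonneg (hw0 σ) (hρ01 σ).1
  · rintro ⟨σ, c⟩ i k hne ⟨i', k'⟩ ⟨h1, h2⟩
    simp only [ne_eq, ite_eq_right_iff, not_forall] at hne h1 h2 ⊢
    obtain ⟨⟨hc, rfl, hi⟩, -⟩ := hne
    refine ⟨?_, h2 hc⟩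
    rintro rfl
    rw [hi] at h1
    exact h2 hc (by simpa using h1.symm)
  · intro i k
    rw [Fintype.sum_prod_type]
    by_cases hk : k = j
    · subst hk
      have : u i k = (u i k / M i k) * M i k := by
        by_cases h0 : M i k = 0
        · have := hu i k
          have := hb i k
          rw [hMj] at h0
          have : u i k = 0 := by linarith
          simp [this]
        · field_simp
      rw [this]
      nth_rw 2 [hw i k]
      rw [Finset.mul_sum]
      refine Finset.sum_congr rfl fun σ _ => ?_
      by_cases hσ : σ (.inl i) = .inr k
      · simp [Set.indicator, hσ, hρeq σ i hσ]; ring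
      · simp [Set.indicator, hσ]
    · have : u i k = M i k := by simp [hM, hk]
      rw [this, hw i k]
      refine Finset.sum_congr rfl fun σ _ => ?_
      by_cases hσ : σ (.inl i) = .inr k
      · simp [Set.indicator, hσ, hk]; ring
      · simp [Set.indicator, hσ]
  · intro i k
    rw [Fintype.sum_prod_type]
    by_cases hk : k = j
    · subst hk
      have : b i k = (1 - u i k / M i k) * M i k := by
        have := hu i k
        have := hb i k
        by_cases h0 : M i k = 0
        · rw [h0, mul_zero]
          rw [hMj] at h0
          linarith
        · rw [sub_mul, div_mul_cancel₀ _ h0, hMj]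
          ring
      rw [if_pos rfl, this]
      nth_rw 2 [hw i k]
      rw [Finset.mul_sum]
      refine Finset.sum_congr rfl fun σ _ => ?_
      by_cases hσ : σ (.inl i) = .inr k
      · simp [hσ, hρeq σ i hσ]; ring
      · simp [hσ]
    · simp [hk]

/-! ### Attained minima of scalings -/

/-- If every `t` with `A ⊆ t • C` is at least `1`, and `C` is closed, the least such `t` exists. -/
lemma isLeast_sInf_setOf_subset_smul {E : Type*} [TopologicalSpace E] [AddCommGroup E] [Module ℝ E]
    [ContinuousSMul ℝ E] {A C : Set E} (hC : IsClosed C) (hne : {t : ℝ | A ⊆ t • C}.Nonempty)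
    (h1 : ∀ t : ℝ, A ⊆ t • C → 1 ≤ t) :
    IsLeast {t : ℝ | A ⊆ t • C} (sInf {t : ℝ | A ⊆ t • C}) := by
  have hbdd : BddBelow {t : ℝ | A ⊆ t • C} := ⟨1, fun t ht => h1 t ht⟩
  refine ⟨?_, fun t ht => csInf_le hbdd ht⟩
  -- the point `0` is added so that the constraint `1 ≤ t` survives if `A` is empty
  have heq : {t : ℝ | A ⊆ t • C} = ⋂ a ∈ insert (0 : E) A,
      {t : ℝ | t ∈ Set.Ici (1 : ℝ) ∧ (a ∈ A → t⁻¹ • a ∈ C)} := by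
    ext t
    simp only [Set.mem_ofPred_eq, Set.mem_iInter, Set.mem_Ici]
    constructor
    · intro ht a _
      refine ⟨h1 t ht, fun ha => ?_⟩
      have : t ≠ 0 := by linarith [h1 t ht]
      exact (Set.mem_smul_set_iff_inv_smul_mem₀ this _ _).1 (ht ha)
    · intro h a ha
      obtain ⟨h1, h2⟩ := h a (Set.mem_insert_of_mem _ ha)
      exact (Set.mem_smul_set_iff_inv_smul_mem₀ (by linarith) _ _).2 (h2 ha)
  refine IsClosed.csInf_mem ?_ hne hbdd
  rw [heq]
  refine isClosed_biInter fun a _ => ?_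
  by_cases ha : a ∈ A
  · simp only [ha, true_imp_iff]
    refine ContinuousOn.preimage_isClosed_of_isClosed (f := fun t : ℝ => t⁻¹ • a) ?_ isClosed_Ici hC
    refine ContinuousOn.smul (continuousOn_inv₀.mono fun t ht => ?_) continuousOn_const
    have : (1 : ℝ) ≤ t := ht
    simp only [Set.mem_compl_iff, Set.mem_singleton_iff]
    linarith
  · simpa [ha, Set.Ici] using (isClosed_Ici : IsClosed (Set.Ici (1 : ℝ)))

/-- A scaling that covers a point with a coordinate `1` by a set on which this coordinate lies in
`[0, 1]` is at least `1`. -/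
lemma one_le_of_subset_smul {V : Type*} {A C : Set (V → ℝ)} {a : V → ℝ} (ha : a ∈ A) {v : V}
    (hav : a v = 1) (hC0 : ∀ c ∈ C, 0 ≤ c v) (hC1 : ∀ c ∈ C, c v ≤ 1) {t : ℝ} (ht : A ⊆ t • C) :
    1 ≤ t := by
  obtain ⟨c, hc, hca⟩ := ht ha
  have h1 : t * c v = 1 := by rw [← hav, ← hca]; simp
  have h2 := hC0 c hc
  have h3 := hC1 c hc
  by_contra! hlt
  rcases h2.eq_or_lt with h0 | h0
  · simp [← h0] at h1
  · nlinarith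

/-! ### Spanning by network coding -/

/-- Vectors `(1, a, a², …)` for distinct `a` are in general position: any `n` of them span. -/
lemma span_pow_eq_top {𝔽 : Type*} [Field 𝔽] {ι : Type*} {α : ι → 𝔽} (hα : Function.Injective α)
    {n : ℕ} {T : Set ι} (g : Fin n ↪ T) :
    Submodule.span 𝔽 {v : Fin n → 𝔽 | ∃ t ∈ T, v = fun k : Fin n => α t ^ (k : ℕ)} = ⊤ := by
  have hinj : Function.Injective fun i => α (g i : ι) :=
    hα.comp (Subtype.val_injective.comp g.injective)
  have hli := Matrix.linearIndependent_rows_of_det_ne_zero (Matrix.det_vandermonde_ne_zero_iff.2 hinj)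
  rw [eq_top_iff, ← hli.span_eq_top_of_card_eq_finrank' (by simp)]
  refine Submodule.span_mono ?_
  rintro _ ⟨i, rfl⟩
  exact ⟨g i, (g i).2, by ext k; simp [Matrix.vandermonde_apply]⟩

/-- A frame serves `n f` packets of each flow `f` as soon as its configurations let every output in
the fanout of `f` receive from `f` in at least `n f` slots: over a field with at least as many
elements as there are slots, the packets can be coded so that any `n f` of the coded packets
determine them. -/
lemma frameServes_of_card_le {K N : ℕ} {P : Finset (SwitchFlow K N)} {F : ℕ} {n : P → ℕ}
    (conf : Fin F → Fin N → Option P) (hconf : ∀ t, IsSwitchConfiguration (conf t))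
    (hn : ∀ f : P, ∀ j ∈ f.1.fanout, n f ≤ Nat.card {t | conf t j = some f}) :
    FrameServes P F n := by
  obtain ⟨p, hFp, hp⟩ := Nat.exists_infinite_primes F
  have : Fact p.Prime := ⟨hp⟩
  have hα : Function.Injective fun t : Fin F => ((t : ℕ) : ZMod p) := by
    intro s t hst
    have h := (ZMod.natCast_eq_natCast_iff' _ _ _).1 hst
    rw [Nat.mod_eq_of_lt (s.2.trans_le hFp), Nat.mod_eq_of_lt (t.2.trans_le hFp)] at h
    exact Fin.ext h
  refine ⟨ZMod p, inferInstance, inferInstance, conf, fun t f k => ((t : ℕ) : ZMod p) ^ (k : ℕ),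
    hconf, fun f j hj => ?_⟩
  obtain ⟨g⟩ : Nonempty (Fin (n f) ↪ {t | conf t j = some f}) := by
    have := Fintype.ofFinite {t | conf t j = some f}
    refine Function.Embedding.nonempty_of_card_le ?_
    rw [Fintype.card_fin, ← Nat.card_eq_fintype_card]
    exact hn f j hj
  exact span_pow_eq_top hα g

/-! ### From stable sets to achievable rates -/

/-- Frames realising a probability vector up to rounding: `⌊w i * F⌋` of the `F` slots are labelled
`i`, the remaining ones are idle. -/
lemma exists_slot_labelling {ι : Type*} [Fintype ι] {w : ι → ℝ} (hw0 : ∀ i, 0 ≤ w i)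
    (hw1 : ∑ i, w i = 1) (F : ℕ) :
    ∃ s : Fin F → Option ι, ∀ I : Finset ι,
      F * ∑ i ∈ I, w i - Fintype.card ι ≤ Nat.card {t | ∃ i ∈ I, s t = some i} := by
  classical
  set a : ι → ℕ := fun i => ⌊w i * F⌋₊ with ha
  have hle : ∀ i, (a i : ℝ) ≤ w i * F := fun i =>
    Nat.floor_le (mul_nonneg (hw0 i) (Nat.cast_nonneg F))
  obtain ⟨g⟩ : Nonempty ((Σ i, Fin (a i)) ↪ Fin F) := by
    refine Function.Embedding.nonempty_of_card_le ?_
    simp only [Fintype.card_sigma, Fintype.card_fin]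
    have : (∑ i, (a i : ℝ)) ≤ F := by
      refine (Finset.sum_le_sum fun i _ => hle i).trans ?_
      rw [← Finset.sum_mul, hw1, one_mul]
    exact_mod_cast this
  refine ⟨Function.extend g (fun x => some x.1) (fun _ => none), fun I => ?_⟩
  have hcard : ∑ i ∈ I, a i ≤
      Nat.card {t | ∃ i ∈ I, Function.extend g (fun x => some x.1) (fun _ => none) t = some i} := by
    have : ∑ i ∈ I, a i = Nat.card (I.sigma fun i => (Finset.univ : Finset (Fin (a i)))) := by
      rw [Nat.card_eq_fintype_card, Fintype.card_coe, Finset.card_sigma]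
      simp
    rw [this]
    refine Nat.card_le_card_of_injective
      (fun x => ⟨g x.1, x.1.1, (Finset.mem_sigma.1 x.2).1, ?_⟩) ?_
    · rw [g.injective.extend_apply]
    · intro x y hxy
      exact Subtype.ext (g.injective (congrArg Subtype.val hxy))
  have hsum : F * ∑ i ∈ I, w i - Fintype.card ι ≤ ∑ i ∈ I, (a i : ℝ) := by
    have h1 : ∀ i, w i * F - 1 ≤ a i := fun i => (Nat.sub_one_lt_floor _).le
    have h2 := Finset.sum_le_sum fun i (_ : i ∈ I) => h1 i
    simp only [Finset.sum_sub_distrib, ← Finset.sum_mul, Finset.sum_const, nsmul_eq_mul,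
      mul_one] at h2
    have h3 : (I.card : ℝ) ≤ Fintype.card ι := by exact_mod_cast Finset.card_le_univ I
    linarith
  refine hsum.trans ?_
  exact_mod_cast hcard

/-- The vertex of `G_{K,N}` for the subflow of the flow `f` to output `j`. For `N = 1`, where a flow
is both a unicast and a broadcast, it is the unicast vertex. -/
noncomputable def flowVertex {K N : ℕ} (f : SwitchFlow K N) (j : Fin N) : SwitchVertex K N :=
  open Classical in if f.IsUnicast then .inl (f.input, j) else .inr (f.input, j)

@[ext]
lemma SwitchFlow.ext_of_input_of_fanout {K N : ℕ} {f g : SwitchFlow K N} (h1 : f.input = g.input)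
    (h2 : f.fanout = g.fanout) : f = g := by
  cases f; cases g; simp_all

lemma eq_of_flowVertex_eq {K N : ℕ} {f g : SwitchFlow K N} {j : Fin N}
    (hf : f.IsUnicast ∨ f.IsBroadcast) (hg : g.IsUnicast ∨ g.IsBroadcast)
    (hjf : j ∈ f.fanout) (hjg : j ∈ g.fanout) (h : flowVertex f j = flowVertex g j) : f = g := by
  unfold flowVertex at h
  split_ifs at h with h1 h2 h2
  · obtain ⟨a, ha⟩ := h1
    obtain ⟨c, hc⟩ := h2
    rw [ha, Finset.mem_singleton] at hjf
    rw [hc, Finset.mem_singleton] at hjg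
    ext1
    · simpa using h
    · rw [ha, hc, ← hjf, ← hjg]
  · ext1
    · simpa using h
    · exact (hf.resolve_left h1).trans (hg.resolve_left h2).symm

/-- A stable set of `G_{K,N}` is a configuration of the switch: each output receives the subflow to
it that the stable set contains. -/
lemma exists_configuration_of_isIndepSet {K N : ℕ} {P : Finset (SwitchFlow K N)}
    (hP : ∀ f ∈ P, f.IsUnicast ∨ f.IsBroadcast) {S : Set (SwitchVertex K N)}
    (hS : (switchGraph K N).IsIndepSet S) :
    ∃ conf : Fin N → Option P, IsSwitchConfiguration conf ∧
      ∀ f : P, ∀ j ∈ f.1.fanout, flowVertex f.1 j ∈ S → conf j = some f := by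
  classical
  have huniq : ∀ f g : P, ∀ j, j ∈ f.1.fanout → j ∈ g.1.fanout → flowVertex f.1 j ∈ S →
      flowVertex g.1 j ∈ S → f = g := by
    intro f g j hf hg hfS hgS
    refine Subtype.ext (eq_of_flowVertex_eq (hP _ f.2) (hP _ g.2) hf hg ?_)
    by_contra hne
    refine hS hfS hgS hne ?_
    unfold flowVertex at hne ⊢
    split_ifs at hne ⊢ <;> simp_all [switchGraph, switchAdj]
  refine ⟨fun j => if h : ∃ f : P, j ∈ f.1.fanout ∧ flowVertex f.1 j ∈ S then some h.choose
    else none, ⟨?_, ?_⟩, ?_⟩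
  · intro j f hf
    dsimp only at hf
    split_ifs at hf with h
    · rw [← Option.some_injective _ hf]
      exact h.choose_spec.1
  · intro j j' f f' hf hf' hin
    dsimp only at hf hf'
    split_ifs at hf hf' with h h'
    obtain ⟨h1, h2⟩ := h.choose_spec
    obtain ⟨h1', h2'⟩ := h'.choose_spec
    rw [Option.some_injective _ hf] at h1 h2
    rw [Option.some_injective _ hf'] at h1' h2'
    have hnadj := fun hne => hS h2 h2' hne
    unfold flowVertex at hnadj
    split_ifs at hnadj with hu hu' hu'
    · obtain ⟨a, ha⟩ := hu
      obtain ⟨c, hc⟩ := hu'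
      refine Subtype.ext (SwitchFlow.ext_of_input_of_fanout hin ?_)
      have hjj : j = j' := by
        by_contra hne
        refine hnadj (by simp [hne]) ?_
        simp [switchGraph, switchAdj, hin, hne]
      subst hjj
      rw [ha, Finset.mem_singleton] at h1
      rw [hc, Finset.mem_singleton] at h1'
      rw [ha, hc, ← h1, ← h1']
    · exact absurd (by simp [switchGraph, switchAdj, hin]) (hnadj (by simp))
    · exact absurd (by simp [switchGraph, switchAdj, hin]) (hnadj (by simp))
    · exact Subtype.ext (SwitchFlow.ext_of_input_of_fanout hin
        (((hP _ f.2).resolve_left hu).trans ((hP _ f'.2).resolve_left hu').symm))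
  · intro f j hj hfS
    have h : ∃ f : P, j ∈ f.1.fanout ∧ flowVertex f.1 j ∈ S := ⟨f, hj, hfS⟩
    simp only [h, dif_pos]
    exact congrArg some (huniq _ _ j h.choose_spec.1 hj h.choose_spec.2 hfS)

/-- Rates dominated on every subflow by a point of the stable set polytope are achievable: time is
shared between the configurations of the stable sets, and coding lets every output collect the
packets of a flow at its own times. -/
lemma mem_achievableRegion_of_mem_stab {K N : ℕ} {P : Finset (SwitchFlow K N)}
    (hP : ∀ f ∈ P, f.IsUnicast ∨ f.IsBroadcast) {x : SwitchVertex K N → ℝ}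
    (hx : x ∈ stab (switchGraph K N)) {r : P → ℝ} (hr0 : ∀ f, 0 ≤ r f)
    (hr : ∀ f : P, ∀ j ∈ f.1.fanout, r f ≤ x (flowVertex f.1 j)) :
    r ∈ achievableRegion P := by
  classical
  obtain ⟨ι, _, w, z, hw0, hw1, hz, rfl⟩ := mem_convexHull_iff_exists_fintype.1 hx
  choose S hS hzS using hz
  choose conf hconf hconfS using fun i => exists_configuration_of_isIndepSet hP (hS i)
  -- rounding the weights costs each output at most `card ι` slots of each flow
  set n : ℕ → P → ℕ := fun F f => ⌊F * r f - Fintype.card ι⌋₊ with hn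
  have hserve : ∀ F, FrameServes P F (n F) := by
    intro F
    obtain ⟨s, hs⟩ := exists_slot_labelling hw0 hw1 F
    refine frameServes_of_card_le (fun t j => (s t).elim none (conf · j)) (fun t => ?_) ?_
    · rcases hst : s t with _ | i
      · exact ⟨by simp, by simp⟩
      · exact hconf i
    · intro f j hj
      have hsub : Nat.card {t | ∃ i ∈ Finset.univ.filter (flowVertex f.1 j ∈ S ·), s t = some i} ≤
          Nat.card {t | (s t).elim none (conf · j) = some f} := by
        refine Nat.card_mono (Set.toFinite _) ?_
        rintro t ⟨i, hi, hst⟩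
        simp only [Finset.mem_filter, Finset.mem_univ, true_and] at hi
        simp only [Set.mem_ofPred_eq, hst, Option.elim]
        exact hconfS i f j hj hi
      refine le_trans (Nat.floor_le_of_le ?_) hsub
      refine le_trans ?_ (hs _)
      gcongr
      refine (hr f j hj).trans (le_of_eq ?_)
      rw [Finset.sum_apply, Finset.sum_filter]
      refine Finset.sum_congr rfl fun i _ => ?_
      simp [hzS, Set.indicator_apply]
  refine mem_closure_of_tendsto (f := fun F : ℕ => fun f => (n F f : ℝ) / F) (b := Filter.atTop) ?_
    ((Filter.eventually_gt_atTop 0).mono fun F hF => ⟨F, n F, hF, hserve F, fun _ => rfl⟩)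
  rw [tendsto_pi_nhds]
  intro f
  -- `F * r f - (card ι + 1) ≤ n F f ≤ F * r f`
  have hlim : Filter.Tendsto (fun F : ℕ => r f - (Fintype.card ι + 1 : ℝ) / F) Filter.atTop
      (nhds (r f)) := by
    simpa using tendsto_const_nhds.sub (tendsto_const_div_atTop_nhds_zero_nat
      (Fintype.card ι + 1 : ℝ))
  refine tendsto_of_tendsto_of_tendsto_of_le_of_le' hlim tendsto_const_nhds ?_ ?_
  · filter_upwards [Filter.eventually_gt_atTop 0] with F hF
    have hF' : (0 : ℝ) < F := by exact_mod_cast hF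
    rw [le_div_iff₀ hF', sub_mul, div_mul_cancel₀ _ hF'.ne']
    have := Nat.sub_one_lt_floor ((F : ℝ) * r f - Fintype.card ι)
    simp only [hn]
    linarith
  · filter_upwards [Filter.eventually_gt_atTop 0] with F hF
    have hF' : (0 : ℝ) < F := by exact_mod_cast hF
    rw [div_le_iff₀ hF']
    have h0 : (0 : ℝ) ≤ r f * F := mul_nonneg (hr0 f) hF'.le
    have h : n F f ≤ ⌊r f * F⌋₊ := by
      refine Nat.floor_le_floor ?_
      have : (0 : ℝ) ≤ Fintype.card ι := Nat.cast_nonneg _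
      linarith
    exact (Nat.cast_le.2 h).trans (Nat.floor_le h0)

/-- Achievable rates lie in `[0, 1]`, as a frame of `F` slots cannot give an output more than `F`
independent coefficient vectors. -/
lemma mem_Icc_of_mem_achievableRegion {K N : ℕ} {P : Finset (SwitchFlow K N)} {r : P → ℝ}
    (hr : r ∈ achievableRegion P) (f : P) : r f ∈ Set.Icc (0 : ℝ) 1 := by
  have hcl : IsClosed {r : P → ℝ | r f ∈ Set.Icc (0 : ℝ) 1} :=
    isClosed_Icc.preimage (continuous_apply f)
  refine closure_minimal ?_ hcl hr
  rintro r ⟨F, n, hF, ⟨𝔽, _, _, conf, c, -, hspan⟩, hrn⟩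
  obtain ⟨j, hj⟩ := f.1.fanout_nonempty
  have hle : n f ≤ F := by
    have h1 : Submodule.span 𝔽 (Set.range fun t => c t f) = ⊤ := by
      rw [eq_top_iff, ← hspan f j hj]
      refine Submodule.span_mono ?_
      rintro _ ⟨t, -, rfl⟩
      exact ⟨t, rfl⟩
    have h2 := finrank_range_le_card (R := 𝔽) fun t => c t f
    rw [Set.finrank, h1, finrank_top] at h2
    simpa using h2
  have hF' : (0 : ℝ) < F := by exact_mod_cast hF
  rw [Set.mem_ofPred_eq, hrn]
  exact ⟨by positivity, (div_le_one hF').2 (by exact_mod_cast hle)⟩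

/-! ### Two scalings of loads into the stable set polytope -/

lemma IsSwitchLoad.unicast_only {K N : ℕ} {u b : Fin K → Fin N → ℝ} (h : IsSwitchLoad u b) :
    IsSwitchLoad u 0 where
  unicast_nonneg := h.unicast_nonneg
  broadcast_nonneg _ _ := le_rfl
  input_le i j := by
    have := h.input_le i j
    have := h.broadcast_nonneg i j
    simp only [Pi.zero_apply]; linarith
  output_le j := by
    have := h.output_le j
    have := Finset.sum_nonneg fun i (_ : i ∈ Finset.univ) => h.broadcast_nonneg i j
    simp only [Pi.zero_apply, Finset.sum_const_zero]; linarith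

/-- For each output `j`, take the load restricted to the unicasts to `j` and all broadcasts, and the
load restricted to all unicasts and the broadcast subflows to `j`. These `2 N` points of the stable
set polytope add up to `N + 1` times the load. -/
lemma IsSwitchLoad.smul_mem_stab_of_output {K N : ℕ} (hN : 1 ≤ N) {u b : Fin K → Fin N → ℝ}
    (h : IsSwitchLoad u b) :
    (2 * (N : ℝ) / (N + 1))⁻¹ • switchVec u b ∈ stab (switchGraph K N) := by
  have hN' : (0 : ℝ) < N := by exact_mod_cast hN
  have := (convex_stab (switchGraph K N)).sum_mem (t := Finset.univ)
    (w := fun _ : Fin N ⊕ Fin N => (1 / (2 * N) : ℝ))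
    (z := Sum.elim (fun j => switchVec (fun i k => if k = j then u i k else 0) b)
      (fun j => switchVec u (fun i k => if k = j then b i k else 0)))
    (fun _ _ => by positivity)
    (by simp only [Finset.sum_const, Finset.card_univ, Fintype.card_sum, Fintype.card_fin,
          nsmul_eq_mul, Nat.cast_add]
        field_simp; norm_num)
    (by rintro (j | j) -
        exacts [h.column_mem_stab j, h.unicast_mem_stab j])
  convert this using 1
  ext (⟨i, k⟩ | ⟨i, k⟩) <;>
  · simp [switchVec, Fintype.sum_sum_type, Finset.sum_apply]
    field_simp
    try ring

/-- For each input `i`, take the load restricted to the unicasts of `i` and all broadcasts; add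
`K - 1` copies of the load restricted to the unicasts. These `2 K - 1` points of the stable set
polytope add up to `K` times the load. -/
lemma IsSwitchLoad.smul_mem_stab_of_input {K N : ℕ} (hK : 1 ≤ K) (hN : 1 ≤ N)
    {u b : Fin K → Fin N → ℝ} (h : IsSwitchLoad u b) :
    ((2 * (K : ℝ) - 1) / K)⁻¹ • switchVec u b ∈ stab (switchGraph K N) := by
  have hK' : (1 : ℝ) ≤ K := by exact_mod_cast hK
  have hpos : (0 : ℝ) < 2 * K - 1 := by linarith
  have huni : switchVec u 0 ∈ stab (switchGraph K N) := by
    convert h.unicast_only.unicast_mem_stab ⟨0, hN⟩ using 2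
    ext; simp
  have := (convex_stab (switchGraph K N)).sum_mem (t := Finset.univ)
    (w := fun o : Option (Fin K) => o.elim (((K : ℝ) - 1) / (2 * K - 1)) fun _ => 1 / (2 * K - 1))
    (z := fun o => o.elim (switchVec u 0)
      (fun i => switchVec (fun k j => if k = i then u k j else 0) b))
    (by rintro (_ | i) -
        · exact div_nonneg (by linarith) hpos.le
        · exact div_nonneg zero_le_one hpos.le)
    (by simp only [Fintype.sum_option, Option.elim, Finset.sum_const, Finset.card_univ,
          Fintype.card_fin, nsmul_eq_mul]
        rw [mul_one_div, ← add_div, div_eq_one_iff_eq hpos.ne']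
        ring)
    (by rintro (_ | i) -
        exacts [huni, h.row_mem_stab i])
  convert this using 1
  ext (⟨i, k⟩ | ⟨i, k⟩) <;>
  · simp [switchVec, Fintype.sum_option, Finset.sum_apply]
    field_simp
    try ring

/-! ### The imperfection ratio -/

lemma isSwitchLoad_of_mem_qstab {K N : ℕ} {x : SwitchVertex K N → ℝ}
    (hx : x ∈ qstab (switchGraph K N)) :
    IsSwitchLoad (fun i j => x (.inl (i, j))) (fun i j => x (.inr (i, j))) where
  unicast_nonneg _ _ := hx.1 _
  broadcast_nonneg _ _ := hx.1 _
  input_le i j := by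
    have := hx.2 ((Finset.univ.map (.sectR i (Fin N))).disjSum
      {(i, j)}) ?_
    · simpa [Finset.sum_disjSum] using this
    · rintro (⟨a, c⟩ | ⟨a, c⟩) h (⟨a', c'⟩ | ⟨a', c'⟩) h' hne <;>
        simp at h h' <;> simp_all [switchGraph, switchAdj]
  output_le j := by
    have := hx.2 ((Finset.univ.map (.sectL (Fin K) j)).disjSum
      (Finset.univ.map (.sectL (Fin K) j))) ?_
    · simpa [Finset.sum_disjSum] using this
    · rintro (⟨a, c⟩ | ⟨a, c⟩) h (⟨a', c'⟩ | ⟨a', c'⟩) h' hne <;>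
        simp at h h' <;> simp_all [switchGraph, switchAdj]

lemma isClosed_stab {V : Type*} [Finite V] (G : SimpleGraph V) : IsClosed (stab G) := by
  refine Set.Finite.isClosed_convexHull (𝕜 := ℝ) ?_
  refine (Set.finite_range fun S : Set V => (S.indicator 1 : V → ℝ)).subset ?_
  rintro _ ⟨S, -, rfl⟩
  exact ⟨S, rfl⟩

lemma mem_Icc_of_mem_stab {V : Type*} {G : SimpleGraph V} {x : V → ℝ} (hx : x ∈ stab G) (v : V) :
    x v ∈ Set.Icc (0 : ℝ) 1 := by
  have hconv : Convex ℝ {x : V → ℝ | x v ∈ Set.Icc (0 : ℝ) 1} :=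
    (convex_Icc (0 : ℝ) 1).is_linear_preimage (f := fun x : V → ℝ => x v)
      ⟨fun _ _ => rfl, fun _ _ => rfl⟩
  refine convexHull_min ?_ hconv hx
  rintro _ ⟨S, -, rfl⟩
  by_cases h : v ∈ S <;> simp [h]

lemma single_mem_qstab {V : Type*} [DecidableEq V] (G : SimpleGraph V) (v : V) :
    (Pi.single v 1 : V → ℝ) ∈ qstab G := by
  refine ⟨fun w => ?_, fun Q _ => ?_⟩
  · by_cases h : w = v
    · subst h; simp
    · simp [h]
  · by_cases h : v ∈ Q <;> simp [Pi.single_apply, h]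

lemma one_le_of_mem_imperfectionScalings {V : Type*} [Nonempty V] {G : SimpleGraph V} {t : ℝ}
    (ht : t ∈ imperfectionScalings G) : 1 ≤ t := by
  classical
  obtain ⟨v⟩ := ‹Nonempty V›
  exact one_le_of_subset_smul (single_mem_qstab G v) (v := v) (by simp)
    (fun c hc => (mem_Icc_of_mem_stab hc v).1) (fun c hc => (mem_Icc_of_mem_stab hc v).2) ht

lemma mem_imperfectionScalings_switchGraph {K N : ℕ} (hN : 1 ≤ N) :
    2 * (N : ℝ) / (N + 1) ∈ imperfectionScalings (switchGraph K N) := by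
  have hN' : (0 : ℝ) < N := by exact_mod_cast hN
  intro x hx
  rw [Set.mem_smul_set_iff_inv_smul_mem₀ (by positivity)]
  convert (isSwitchLoad_of_mem_qstab hx).smul_mem_stab_of_output hN using 2
  ext (⟨i, j⟩ | ⟨i, j⟩) <;> rfl

/-! ### The speedup -/

/-- The loads caused by admissible rates. -/
lemma exists_isSwitchLoad_of_mem_admissibleRegion {K N : ℕ} {P : Finset (SwitchFlow K N)}
    (hP : ∀ f ∈ P, f.IsUnicast ∨ f.IsBroadcast) {r : P → ℝ} (hr : r ∈ admissibleRegion P) :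
    ∃ u b : Fin K → Fin N → ℝ, IsSwitchLoad u b ∧
      ∀ f : P, ∀ j ∈ f.1.fanout, r f ≤ switchVec u b (flowVertex f.1 j) := by
  classical
  obtain ⟨hr0, hri, hro⟩ := hr
  refine ⟨fun i j => ∑ f : P, if f.1.input = i ∧ f.1.fanout = {j} then r f else 0,
    fun i _ => ∑ f : P, if f.1.input = i ∧ ¬ f.1.IsUnicast then r f else 0, ⟨?_, ?_, ?_, ?_⟩, ?_⟩
  · exact fun i j => Finset.sum_nonneg fun f _ => by split_ifs; exacts [hr0 f, le_rfl]
  · exact fun i j => Finset.sum_nonneg fun f _ => by split_ifs; exacts [hr0 f, le_rfl]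
  · intro i _
    refine le_trans (le_of_eq ?_) (hri i)
    rw [Finset.sum_comm, ← Finset.sum_add_distrib]
    refine Finset.sum_congr rfl fun f _ => ?_
    by_cases hi : f.1.input = i
    · by_cases hu : f.1.IsUnicast
      · obtain ⟨a, ha⟩ := id hu
        simp [hi, hu, ha]
      · have : ∀ k, f.1.fanout ≠ {k} := fun k hk => hu ⟨k, hk⟩
        simp [hi, hu, this]
    · simp [hi]
  · intro j
    refine le_trans (le_of_eq ?_) (hro j)
    rw [Finset.sum_comm, Finset.sum_comm (s := Finset.univ (α := Fin K)),
      ← Finset.sum_add_distrib]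
    refine Finset.sum_congr rfl fun f _ => ?_
    by_cases hu : f.1.IsUnicast
    · obtain ⟨a, ha⟩ := id hu
      by_cases haj : a = j
      · simp [hu, ha, haj]
      · simp [hu, ha, haj, Ne.symm haj]
    · have h1 : f.1.fanout = Finset.univ := (hP _ f.2).resolve_left hu
      have h2 : ∀ k, f.1.fanout ≠ {k} := fun k hk => hu ⟨k, hk⟩
      have h3 : j ∈ f.1.fanout := by simp [h1]
      simp [hu, h2, h3]
  · intro f j hj
    have hle : ∀ (p : P → Prop) [DecidablePred p], p f → r f ≤ ∑ g : P, if p g then r g else 0 := by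
      intro p _ hp
      refine le_trans (by simp [hp]) (Finset.single_le_sum (f := fun g => if p g then r g else 0)
        (fun g _ => ?_) (Finset.mem_univ f))
      split_ifs
      exacts [hr0 g, le_rfl]
    unfold flowVertex
    split_ifs with hu
    · obtain ⟨a, ha⟩ := hu
      have : a = j := by rw [ha, Finset.mem_singleton] at hj; exact hj.symm
      subst this
      exact hle (fun g => g.1.input = f.1.input ∧ g.1.fanout = {a}) ⟨rfl, ha⟩
    · exact hle (fun g => g.1.input = f.1.input ∧ ¬ g.1.IsUnicast) ⟨rfl, hu⟩

/-- A positive scaling that brings all loads into the stable set polytope is a sufficient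
speedup. -/
lemma mem_sufficientSpeedups_of_forall_load {K N : ℕ} {P : Finset (SwitchFlow K N)}
    (hP : ∀ f ∈ P, f.IsUnicast ∨ f.IsBroadcast) {s : ℝ} (hs : 0 < s)
    (h : ∀ u b : Fin K → Fin N → ℝ, IsSwitchLoad u b →
      s⁻¹ • switchVec u b ∈ stab (switchGraph K N)) :
    s ∈ sufficientSpeedups P := by
  intro r hr
  rw [Set.mem_smul_set_iff_inv_smul_mem₀ hs.ne']
  obtain ⟨u, b, hub, hle⟩ := exists_isSwitchLoad_of_mem_admissibleRegion hP hr
  refine mem_achievableRegion_of_mem_stab hP (h u b hub)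
    (fun f => mul_nonneg (inv_nonneg.2 hs.le) (hr.1 f)) fun f j hj => ?_
  exact mul_le_mul_of_nonneg_left (hle f j hj) (inv_nonneg.2 hs.le)

lemma one_le_of_mem_sufficientSpeedups {K N : ℕ} {P : Finset (SwitchFlow K N)} (hne : P.Nonempty)
    {s : ℝ} (hs : s ∈ sufficientSpeedups P) : 1 ≤ s := by
  classical
  obtain ⟨f, hf⟩ := hne
  have hmem : (Pi.single ⟨f, hf⟩ 1 : P → ℝ) ∈ admissibleRegion P := by
    have hle : ∀ (p : P → Prop) [DecidablePred p],
        ∑ g : P, (if p g then (Pi.single ⟨f, hf⟩ 1 : P → ℝ) g else 0) ≤ 1 := by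
      intro p _
      rw [Finset.sum_eq_single ⟨f, hf⟩ (fun g _ hg => by simp [hg]) (by simp)]
      split_ifs <;> simp
    refine ⟨fun g => ?_, fun i => hle _, fun j => hle _⟩
    by_cases h : g = ⟨f, hf⟩
    · subst h; simp
    · simp [h]
  exact one_le_of_subset_smul hmem (v := ⟨f, hf⟩) (by simp)
    (fun c hc => (mem_Icc_of_mem_achievableRegion hc _).1)
    (fun c hc => (mem_Icc_of_mem_achievableRegion hc _).2) hs

theorem mainTheorem3 (K N : ℕ) (hK : 1 ≤ K) (hN : 1 ≤ N) :
    (IsLeast (imperfectionScalings (switchGraph K N)) (imp (switchGraph K N)) ∧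
      imp (switchGraph K N) ≤ 2 * (N : ℝ) / ((N : ℝ) + 1)) ∧
    ∀ P : Finset (SwitchFlow K N), P.Nonempty → (∀ f ∈ P, f.IsUnicast ∨ f.IsBroadcast) →
      IsLeast (sufficientSpeedups P) (minSpeedup P) ∧
      minSpeedup P ≤ min ((2 * (K : ℝ) - 1) / (K : ℝ)) (2 * (N : ℝ) / ((N : ℝ) + 1)) := by
  have hK' : (1 : ℝ) ≤ K := by exact_mod_cast hK
  have hN' : (1 : ℝ) ≤ N := by exact_mod_cast hN
  have : Nonempty (SwitchVertex K N) := ⟨.inl (⟨0, hK⟩, ⟨0, hN⟩)⟩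
  have himp : IsLeast (imperfectionScalings (switchGraph K N)) (imp (switchGraph K N)) :=
    isLeast_sInf_setOf_subset_smul (isClosed_stab _) ⟨_, mem_imperfectionScalings_switchGraph hN⟩
      fun t ht => one_le_of_mem_imperfectionScalings ht
  refine ⟨⟨himp, himp.2 (mem_imperfectionScalings_switchGraph hN)⟩, fun P hne hP => ?_⟩
  have hin : (2 * (K : ℝ) - 1) / K ∈ sufficientSpeedups P :=
    mem_sufficientSpeedups_of_forall_load hP (div_pos (by linarith) (by linarith))
      fun _ _ h => h.smul_mem_stab_of_input hK hN
  have hout : 2 * (N : ℝ) / (N + 1) ∈ sufficientSpeedups P :=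
    mem_sufficientSpeedups_of_forall_load hP (by positivity)
      fun _ _ h => h.smul_mem_stab_of_output hN
  have hmin : IsLeast (sufficientSpeedups P) (minSpeedup P) :=
    isLeast_sInf_setOf_subset_smul isClosed_closure ⟨_, hin⟩
      fun s hs => one_le_of_mem_sufficientSpeedups hne hs
  exact ⟨hmin, le_min (hmin.2 hin) (hmin.2 hout)⟩
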